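/- Let $q$ be a complex number with $0<|q|<1$. Write $(x;q)_\infty=\prod_{i\ge 0}(1-xq^i)$, $(x;q)_n=\prod_{0\le i<n}(1-xq^i)$, and $(x_1,\dots,x_r;q)_n=(x_1;q)_n\cdots(x_r;q)_n$ for $n\in\{0,1,2,\dots\}\cup\{\infty\}$. Let $\theta(q,x)=\sum_{n=0}^{\infty}(-1)^nq^{\binom n2}x^n$ and, for an integer $m\ge 2$, $$P_m(a,b)=(q,a,b;q)_\infty\sum_{n=0}^{\infty}\frac{(ab/q^m;q)_{2n}}{(q,a,b,ab/q^m;q)_n}\,q^n,$$ $$Q_m(b)=\sum_{i=0}^{m-2}\frac{(q^{2-m};q)_i}{(q;q)_i\,(bq^i;q)_{m-1}}\,(1-bq^{2i})\,b^{2i}q^{(2i-2+m)i}.$$ **Theorem.** Let $m\ge 2$ be an integer and let $a,b$ be complex numbers for which no denominator below vanishes, that is, $aq^n\ne 1$, $bq^n\ne q^{m-1}$ and $abq^n\ne q^m$ for all integers $n\ge 0$, and $Q_m(bq^{1-m})\neq 0$. Then the series defining $\theta(q,a)$ and $P_m(aq^k,bq^k)$ for $0\le k\le m-1$ converge absolutely,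 and $$\theta(q,a)=\sum_{k=0}^{m-1}\lambda_k(m,b)\,P_m(aq^k,bq^k),\qquad \lambda_k(m,b)=\frac{(q^{m-k};q)_k\,(bq^{k-m+1})^k}{(q;q)_k\,Q_m(bq^{1-m})}.$$ In particular the coefficients $\lambda_k(m,b)$ do not depend on $a$. -/

import Mathlib

namespace PartialTheta

open Finset

/-- The infinite `q`-shifted factorial `(x; q)_∞ = ∏_{i ≥ 0} (1 - x q^i)`. -/
noncomputable def qPochInf (x q : ℂ) : ℂ := ∏' i : ℕ, (1 - x * q ^ i)

/-- The finite `q`-shifted factorial `(x; q)_n = ∏_{0 ≤ i < n} (1 - x q^i)`. -/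
noncomputable def qPoch (x q : ℂ) (n : ℕ) : ℂ := ∏ i ∈ range n, (1 - x * q ^ i)

/-- The product defining `(x; q)_∞` converges for `|q| < 1`. -/
theorem multipliable_qPochInf (x : ℂ) {q : ℂ} (hq : ‖q‖ < 1) :
    Multipliable fun i : ℕ => (1 - x * q ^ i) := by
  have h : Summable fun i : ℕ => ‖-(x * q ^ i)‖ := by
    simp only [norm_neg, norm_mul, norm_pow]
    exact (summable_geometric_of_lt_one (norm_nonneg q) hq).mul_left _
  simpa [sub_eq_add_neg] using multipliable_one_add_of_summable h

/-- `(x; q)_∞ = (x; q)_n (x q^n; q)_∞`, so that the finite product is the quotient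
`(x; q)_∞ / (x q^n; q)_∞` whenever the latter makes sense. -/
theorem qPoch_mul_qPochInf (x : ℂ) {q : ℂ} (hq : ‖q‖ < 1) (n : ℕ) :
    qPoch x q n * qPochInf (x * q ^ n) q = qPochInf x q := by
  have h : Multipliable fun i : ℕ => (1 - x * q ^ (i + n)) := by
    have := multipliable_qPochInf (x * q ^ n) hq
    refine this.congr fun i => ?_
    ring
  have h2 := Multipliable.prod_mul_tprod_nat_mul' (f := fun i : ℕ => (1 - x * q ^ i)) (k := n) h
  rw [qPoch, qPochInf, qPochInf, ← h2]
  congr 1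
  refine tprod_congr fun i => ?_
  ring

/-- The general term `(-1)^n q^{n(n-1)/2} x^n` of the partial theta function. -/
noncomputable def thetaTerm (q x : ℂ) (n : ℕ) : ℂ := (-1) ^ n * q ^ (n.choose 2) * x ^ n

/-- The partial theta function `θ(q, x) = ∑_{n ≥ 0} (-1)^n q^{n(n-1)/2} x^n`. -/
noncomputable def theta (q x : ℂ) : ℂ := ∑' n : ℕ, thetaTerm q x n

/-- The general term `(ab/q^m; q)_{2n} q^n / (q, a, b, ab/q^m; q)_n` of the series in `P_m(a, b)`. -/
noncomputable def PTerm (q : ℂ) (m : ℕ) (a b : ℂ) (n : ℕ) : ℂ :=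
  qPoch (a * b / q ^ m) q (2 * n) /
    (qPoch q q n * qPoch a q n * qPoch b q n * qPoch (a * b / q ^ m) q n) * q ^ n

/-- `P_m(a, b) = (q, a, b; q)_∞ ∑_{n ≥ 0} (ab/q^m; q)_{2n} q^n / (q, a, b, ab/q^m; q)_n`. -/
noncomputable def P (q : ℂ) (m : ℕ) (a b : ℂ) : ℂ :=
  qPochInf q q * qPochInf a q * qPochInf b q * ∑' n : ℕ, PTerm q m a b n

/-- `Q_m(b) = ∑_{i=0}^{m-2} (q^{2-m}; q)_i / ((q; q)_i (b q^i; q)_{m-1})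
(1 - b q^{2i}) b^{2i} q^{(2i-2+m) i}`, for `m ≥ 2`. -/
noncomputable def Q (q : ℂ) (m : ℕ) (b : ℂ) : ℂ :=
  ∑ i ∈ range (m - 1),
    qPoch (q ^ (2 - (m : ℤ))) q i / (qPoch q q i * qPoch (b * q ^ i) q (m - 1)) *
      (1 - b * q ^ (2 * i)) * b ^ (2 * i) * q ^ ((2 * (i : ℤ) - 2 + (m : ℤ)) * (i : ℤ))

/-- The coefficient
`λ_k(m, b) = (q^{m-k}; q)_k (b q^{k-m+1})^k / ((q; q)_k Q_m(b q^{1-m}))`, independent of `a`. -/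
noncomputable def lam (q : ℂ) (m k : ℕ) (b : ℂ) : ℂ :=
  qPoch (q ^ ((m : ℤ) - (k : ℤ))) q k * (b * q ^ ((k : ℤ) - (m : ℤ) + 1)) ^ k /
    (qPoch q q k * Q q m (b * q ^ (1 - (m : ℤ))))

end PartialTheta

namespace PartialTheta

open Finset Filter Topology

/-! Write m = M + 2 and y = q^(2-m), so that y q^M = 1, and let L_b be the functional on power
series that sends X^T to the T-th term of θ(q, b). The plan is to expand both sides in the terms of
θ(q, a) and compare coefficients.

Rearranging an absolutely convergent quadruple series (`hasSum_mul_PTerm`,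
`hasSum_thetaTerm_mul_pairingValue`) shows that the coefficient of the R-th term in P_m(a, b) is L_b
of (yX; q)_R / (X; q)_{R+1}. Replacing b by b q^k amounts to inserting X^k under L_b
(`HasPairing.X_pow_mul`). By the q-binomial theorem, combining the functions P_m(aq^k, bq^k) with
the weights λ_k therefore inserts the factor (y q^R X; q)_{M+1}, up to normalisation. Since y q^M =
1, the denominator cancels and (yX; q)_M is left, whatever R is (`pochSeries_mul_invPochSeries`).
The combination is thus a constant times θ(q, a).

That constant is L_b((yX; q)_M) divided by the normalising Q_m(b q^(1-m)). The two agree by a finite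
Rogers–Ramanujan type identity (`sum_wellPoisedTerm`, `Q_mul_zpow`). -/

/-! ### Finite and infinite q-shifted factorials. -/

@[simp] theorem qPoch_zero (x q : ℂ) : qPoch x q 0 = 1 := by simp [qPoch]

theorem qPoch_succ (x q : ℂ) (n : ℕ) : qPoch x q (n + 1) = qPoch x q n * (1 - x * q ^ n) := by
  simp [qPoch, prod_range_succ]

theorem qPoch_add (x q : ℂ) (m n : ℕ) :
    qPoch x q (m + n) = qPoch x q m * qPoch (x * q ^ m) q n := by
  simp only [qPoch, prod_range_add]
  congr 1
  exact prod_congr rfl fun i _ => by ring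

theorem qPoch_succ' (x q : ℂ) (n : ℕ) : qPoch x q (n + 1) = (1 - x) * qPoch (x * q) q n := by
  rw [add_comm, qPoch_add]
  simp [qPoch]

theorem qPoch_ne_zero {x q : ℂ} (h : ∀ n : ℕ, x * q ^ n ≠ 1) (n : ℕ) : qPoch x q n ≠ 0 :=
  prod_ne_zero_iff.2 fun i _ => sub_ne_zero.2 (h i).symm

theorem mul_pow_self_ne_one {q : ℂ} (hq : ‖q‖ < 1) (n : ℕ) : q * q ^ n ≠ 1 := by
  intro h
  have h1 : ‖q ^ (n + 1)‖ < 1 := by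
    rw [norm_pow]
    exact pow_lt_one₀ (norm_nonneg _) hq (Nat.succ_ne_zero n)
  rw [pow_succ', h, norm_one] at h1
  exact lt_irrefl _ h1

theorem qPoch_self_ne_zero {q : ℂ} (hq : ‖q‖ < 1) (n : ℕ) : qPoch q q n ≠ 0 :=
  qPoch_ne_zero (mul_pow_self_ne_one hq) n

theorem tendsto_qPoch (x : ℂ) {q : ℂ} (hq : ‖q‖ < 1) :
    Tendsto (qPoch x q) atTop (𝓝 (qPochInf x q)) :=
  (multipliable_qPochInf x hq).tendsto_prod_tprod_nat

theorem qPochInf_ne_zero {x q : ℂ} (hq : ‖q‖ < 1) (h : ∀ n : ℕ, x * q ^ n ≠ 1) :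
    qPochInf x q ≠ 0 := by
  have hs : Summable fun i : ℕ => ‖-(x * q ^ i)‖ := by
    simp only [norm_neg, norm_mul, norm_pow]
    exact (summable_geometric_of_lt_one (norm_nonneg q) hq).mul_left _
  have := tprod_one_add_ne_zero_of_summable (f := fun i : ℕ => -(x * q ^ i))
    (fun i => by rw [← sub_eq_add_neg]; exact sub_ne_zero.2 (h i).symm) hs
  simpa [qPochInf, sub_eq_add_neg] using this

/-- The inverses converge to 1/(q; q)_∞, hence are bounded; dividing by (q; q)_n therefore never
harms summability. -/
theorem exists_norm_inv_qPoch_self_le {q : ℂ} (hq : ‖q‖ < 1) :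
    ∃ K : ℝ, 0 ≤ K ∧ ∀ n, ‖(qPoch q q n)⁻¹‖ ≤ K := by
  have h := (tendsto_qPoch q hq).inv₀ (qPochInf_ne_zero hq (mul_pow_self_ne_one hq))
  obtain ⟨K, hK⟩ := (Metric.isBounded_range_of_tendsto _ h).exists_norm_le
  have hK' : ∀ n, ‖(qPoch q q n)⁻¹‖ ≤ K := fun n => hK _ ⟨n, rfl⟩
  exact ⟨K, (norm_nonneg _).trans (hK' 0), hK'⟩

theorem summable_norm_div_qPoch_self {q : ℂ} (hq : ‖q‖ < 1) {f : ℕ → ℂ}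
    (hf : Summable fun n => ‖f n‖) : Summable fun n => ‖f n / qPoch q q n‖ := by
  obtain ⟨K, -, hK⟩ := exists_norm_inv_qPoch_self_le hq
  refine (hf.mul_right K).of_nonneg_of_le (fun _ => norm_nonneg _) fun n => ?_
  rw [div_eq_mul_inv, norm_mul]
  exact mul_le_mul_of_nonneg_left (hK n) (norm_nonneg _)

/-! ### Terms of the partial theta function. -/

theorem choose_two_succ (n : ℕ) : (n + 1).choose 2 = n.choose 2 + n := by
  rw [Nat.choose_succ_succ' n 1, Nat.choose_one_right, add_comm]

theorem choose_two_add (m n : ℕ) : (m + n).choose 2 = m.choose 2 + n.choose 2 + m * n := by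
  induction n with
  | zero => simp
  | succ n ih => rw [← add_assoc, choose_two_succ, ih, choose_two_succ]; ring

@[simp] theorem thetaTerm_zero (q x : ℂ) : thetaTerm q x 0 = 1 := by simp [thetaTerm]

theorem thetaTerm_succ (q x : ℂ) (n : ℕ) :
    thetaTerm q x (n + 1) = -(x * q ^ n) * thetaTerm q x n := by
  simp only [thetaTerm, choose_two_succ]
  ring

theorem thetaTerm_add (q x : ℂ) (m n : ℕ) :
    thetaTerm q x (m + n) = thetaTerm q x m * thetaTerm q x n * q ^ (m * n) := by
  simp only [thetaTerm, choose_two_add]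
  ring

theorem thetaTerm_mul (q x y : ℂ) (n : ℕ) : thetaTerm q (x * y) n = thetaTerm q x n * y ^ n := by
  simp only [thetaTerm]
  ring

theorem summable_norm_thetaTerm {q : ℂ} (hq : ‖q‖ < 1) (x : ℂ) :
    Summable fun n => ‖thetaTerm q x n‖ := by
  have h : Tendsto (fun n : ℕ => ‖x‖ * ‖q‖ ^ n) atTop (𝓝 0) := by
    simpa using (tendsto_pow_atTop_nhds_zero_of_lt_one (norm_nonneg q) hq).const_mul ‖x‖
  refine summable_of_ratio_norm_eventually_le (r := 1 / 2) (by norm_num) ?_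
  filter_upwards [h.eventually (gt_mem_nhds (show (0 : ℝ) < 1 / 2 by norm_num))] with n hn
  rw [norm_norm, norm_norm, thetaTerm_succ, norm_mul, norm_neg, norm_mul, norm_pow]
  exact mul_le_mul_of_nonneg_right hn.le (norm_nonneg _)

/-! ### Euler's two expansions. -/

theorem norm_mul_pow_pow_le {q : ℂ} (hq : ‖q‖ < 1) (c : ℂ) (N n : ℕ) :
    ‖c * (q ^ N) ^ n‖ ≤ ‖c‖ := by
  rw [norm_mul, ← pow_mul, norm_pow]
  exact mul_le_of_le_one_right (norm_nonneg _) (pow_le_one₀ (norm_nonneg _) hq.le)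

theorem summable_mul_pow_pow {q : ℂ} (hq : ‖q‖ < 1) {d : ℕ → ℂ} (hd : Summable fun n => ‖d n‖)
    (N : ℕ) : Summable fun n => d n * (q ^ N) ^ n :=
  Summable.of_norm_bounded hd fun _ => norm_mul_pow_pow_le hq _ _ _

theorem tendsto_tsum_mul_pow_pow {q : ℂ} (hq : ‖q‖ < 1) {d : ℕ → ℂ}
    (hd : Summable fun n => ‖d n‖) :
    Tendsto (fun N : ℕ => ∑' n, d n * (q ^ N) ^ n) atTop (𝓝 (d 0)) := by
  have h : ∑' n, (if n = 0 then d 0 else 0) = d 0 := tsum_ite_eq 0 _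
  rw [← h]
  refine tendsto_tsum_of_dominated_convergence hd (fun n => ?_)
    (Eventually.of_forall fun _ _ => norm_mul_pow_pow_le hq _ _ _)
  rcases eq_or_ne n 0 with rfl | hn
  · simp
  · have h0 := ((tendsto_pow_atTop_nhds_zero_of_norm_lt_one hq).pow n).const_mul (d n)
    simpa [hn] using h0

/-- The factor 1 - q^(n+1) cancels the last factor of (q; q)_{n+1}. For Euler's series F this yields
F(x) = (1 - x) F(xq), or the reciprocal relation, at each x q^N; iterating and letting N → ∞
produces the product. -/
theorem tsum_mul_pow_pow_sub {q : ℂ} (hq : ‖q‖ < 1) {d : ℕ → ℂ} (hd : Summable fun n => ‖d n‖)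
    (N : ℕ) :
    ∑' n, d n * (q ^ N) ^ n - ∑' n, d n * (q ^ (N + 1)) ^ n =
      ∑' n, d (n + 1) * (1 - q * q ^ n) * (q ^ N) ^ (n + 1) := by
  have h1 := summable_mul_pow_pow hq hd N
  have h2 := summable_mul_pow_pow hq hd (N + 1)
  rw [← h1.tsum_sub h2, (h1.sub h2).tsum_eq_zero_add]
  simp only [pow_zero, sub_self, zero_add]
  exact tsum_congr fun n => by ring

/-- Euler's expansion of `(x; q)_∞`. -/
theorem hasSum_qPochInf {q : ℂ} (hq : ‖q‖ < 1) (x : ℂ) :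
    HasSum (fun n => thetaTerm q x n / qPoch q q n) (qPochInf x q) := by
  set d : ℕ → ℂ := fun n => thetaTerm q x n / qPoch q q n with hd_def
  have hd : Summable fun n => ‖d n‖ :=
    summable_norm_div_qPoch_self hq (summable_norm_thetaTerm hq x)
  have hrec : ∀ N : ℕ, ∑' n, d n * (q ^ N) ^ n =
      (1 - x * q ^ N) * ∑' n, d n * (q ^ (N + 1)) ^ n := by
    intro N
    have h := tsum_mul_pow_pow_sub hq hd N
    have h' : ∀ n, d (n + 1) * (1 - q * q ^ n) * (q ^ N) ^ (n + 1) =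
        -(x * q ^ N) * (d n * (q ^ (N + 1)) ^ n) := by
      intro n
      have h1 := qPoch_self_ne_zero hq n
      have h2 : 1 - q * q ^ n ≠ 0 := sub_ne_zero.2 (mul_pow_self_ne_one hq n).symm
      simp only [hd_def, thetaTerm_succ, qPoch_succ]
      generalize 1 - q * q ^ n = u at h2 ⊢
      field_simp
      ring
    simp only [h', tsum_mul_left] at h
    linear_combination h
  have hiter : ∀ N : ℕ, ∑' n, d n * (q ^ 0) ^ n = qPoch x q N * ∑' n, d n * (q ^ N) ^ n := by
    intro N
    induction N with
    | zero => simp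
    | succ N ih => rw [ih, hrec N, qPoch_succ]; ring
  have hlim := (tendsto_qPoch x hq).mul (tendsto_tsum_mul_pow_pow hq hd)
  simp only [← hiter] at hlim
  have := tendsto_nhds_unique hlim tendsto_const_nhds
  simp only [hd_def, thetaTerm_zero, qPoch_zero, div_one, mul_one, pow_zero, one_pow] at this
  rw [this]
  exact hd.of_norm.hasSum

/-- Euler's expansion of `1 / (x; q)_∞`. -/
theorem hasSum_inv_qPochInf {q : ℂ} (hq : ‖q‖ < 1) {x : ℂ} (hx : ‖x‖ < 1) :
    HasSum (fun n => x ^ n / qPoch q q n) (qPochInf x q)⁻¹ := by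
  set d : ℕ → ℂ := fun n => x ^ n / qPoch q q n with hd_def
  have hd : Summable fun n => ‖d n‖ := summable_norm_div_qPoch_self hq <| by
    simpa only [norm_pow] using summable_geometric_of_lt_one (norm_nonneg x) hx
  have hrec : ∀ N : ℕ, ∑' n, d n * (q ^ (N + 1)) ^ n =
      (1 - x * q ^ N) * ∑' n, d n * (q ^ N) ^ n := by
    intro N
    have h := tsum_mul_pow_pow_sub hq hd N
    have h' : ∀ n, d (n + 1) * (1 - q * q ^ n) * (q ^ N) ^ (n + 1) =
        (x * q ^ N) * (d n * (q ^ N) ^ n) := by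
      intro n
      have h1 := qPoch_self_ne_zero hq n
      have h2 : 1 - q * q ^ n ≠ 0 := sub_ne_zero.2 (mul_pow_self_ne_one hq n).symm
      simp only [hd_def, qPoch_succ]
      generalize 1 - q * q ^ n = u at h2 ⊢
      field_simp
      ring
    simp only [h', tsum_mul_left] at h
    linear_combination -h
  have hiter : ∀ N : ℕ, ∑' n, d n * (q ^ N) ^ n = qPoch x q N * ∑' n, d n * (q ^ 0) ^ n := by
    intro N
    induction N with
    | zero => simp
    | succ N ih => rw [hrec N, ih, qPoch_succ]; ring
  have hlim := (tendsto_tsum_mul_pow_pow hq hd).congr hiter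
  have := tendsto_nhds_unique hlim ((tendsto_qPoch x hq).mul_const _)
  simp only [hd_def, qPoch_zero, div_one, pow_zero, one_pow, mul_one] at this
  rw [inv_eq_of_mul_eq_one_right this.symm]
  exact hd.of_norm.hasSum

theorem norm_pow_succ_lt_one {q : ℂ} (hq : ‖q‖ < 1) (n : ℕ) : ‖q ^ (n + 1)‖ < 1 := by
  rw [norm_pow]
  exact pow_lt_one₀ (norm_nonneg _) hq (Nat.succ_ne_zero n)

/-- Expand (q; q)_N = (q; q)_∞ / (q^(N+1); q)_∞ by Euler. This evaluates the sum over l in the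
quadruple series. -/
theorem hasSum_qPoch_self {q : ℂ} (hq : ‖q‖ < 1) (N : ℕ) :
    HasSum (fun n => qPochInf q q * ((q ^ (N + 1)) ^ n / qPoch q q n)) (qPoch q q N) := by
  have h := (hasSum_inv_qPochInf hq (norm_pow_succ_lt_one hq N)).mul_left (qPochInf q q)
  have h1 := qPoch_mul_qPochInf q hq N
  have h2 := qPochInf_ne_zero hq (mul_pow_self_ne_one hq)
  rw [← pow_succ'] at h1
  have h3 : qPochInf (q ^ (N + 1)) q ≠ 0 := fun h0 => h2 (by rw [← h1, h0, mul_zero])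
  rwa [← h1, mul_assoc, mul_inv_cancel₀ h3, mul_one, h1] at h

/-! ### Gaussian binomials and the finite q-binomial theorem. -/

/-- The Gaussian binomial coefficient. -/
noncomputable def qBinom (q : ℂ) (n k : ℕ) : ℂ :=
  if k ≤ n then qPoch q q n / (qPoch q q k * qPoch q q (n - k)) else 0

theorem qBinom_of_lt (q : ℂ) {n k : ℕ} (h : n < k) : qBinom q n k = 0 := if_neg h.not_ge

theorem qBinom_add (q : ℂ) (k l : ℕ) :
    qBinom q (k + l) k = qPoch q q (k + l) / (qPoch q q k * qPoch q q l) := by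
  simp [qBinom]

theorem qBinom_zero_right {q : ℂ} (hq : ‖q‖ < 1) (n : ℕ) : qBinom q n 0 = 1 := by
  simp [qBinom, div_self (qPoch_self_ne_zero hq n)]

theorem qBinom_self {q : ℂ} (hq : ‖q‖ < 1) (n : ℕ) : qBinom q n n = 1 := by
  simp [qBinom, div_self (qPoch_self_ne_zero hq n)]

theorem qBinom_succ_succ {q : ℂ} (hq : ‖q‖ < 1) {n k : ℕ} (h : k ≤ n) :
    qBinom q (n + 1) (k + 1) = qBinom q n (k + 1) + q ^ (n - k) * qBinom q n k := by
  obtain ⟨l, rfl⟩ := Nat.exists_eq_add_of_le h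
  rcases l with _ | l
  · simp [qBinom_self hq, qBinom_of_lt]
  · have e1 : k + (l + 1) + 1 = (k + 1) + (l + 1) := by ring
    have e2 : k + (l + 1) = (k + 1) + l := by ring
    rw [Nat.add_sub_cancel_left, qBinom_add, e1, qBinom_add, e2, qBinom_add, ← e2, ← e1]
    have h1 := qPoch_self_ne_zero hq k
    have h2 := qPoch_self_ne_zero hq l
    have h3 : 1 - q * q ^ k ≠ 0 := sub_ne_zero.2 (mul_pow_self_ne_one hq k).symm
    have h4 : 1 - q * q ^ l ≠ 0 := sub_ne_zero.2 (mul_pow_self_ne_one hq l).symm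
    rw [qPoch_succ q q (k + (l + 1)), qPoch_succ q q k, qPoch_succ q q l]
    have e3 : 1 - q * q ^ (k + (l + 1)) = (1 - q * q ^ l) + q ^ (l + 1) * (1 - q * q ^ k) := by
      ring
    rw [e3]
    generalize 1 - q * q ^ k = u at h3 ⊢
    generalize 1 - q * q ^ l = v at h4 ⊢
    field_simp

theorem qBinom_mul_one_sub {q : ℂ} (hq : ‖q‖ < 1) {n k : ℕ} (h : k ≤ n) :
    qBinom q (n + 1) k * (1 - q ^ (n + 1 - k)) = (1 - q ^ (n + 1)) * qBinom q n k := by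
  obtain ⟨l, rfl⟩ := Nat.exists_eq_add_of_le h
  have e : k + l + 1 - k = l + 1 := by omega
  rw [e, qBinom_add, add_assoc, qBinom_add, ← add_assoc, qPoch_succ q q (k + l), qPoch_succ q q l,
    pow_succ', pow_succ']
  have h1 := qPoch_self_ne_zero hq k
  have h2 := qPoch_self_ne_zero hq l
  have h4 : 1 - q * q ^ l ≠ 0 := sub_ne_zero.2 (mul_pow_self_ne_one hq l).symm
  generalize 1 - q * q ^ l = v at h4 ⊢
  field_simp

/-- The finite `q`-binomial theorem. -/
theorem prod_one_sub_smul {A : Type*} [CommRing A] [Algebra ℂ A] {q : ℂ} (hq : ‖q‖ < 1) (y : ℂ)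
    (x : A) (N : ℕ) :
    ∏ i ∈ range N, (1 - (y * q ^ i) • x) =
      ∑ k ∈ range (N + 1), (qBinom q N k * thetaTerm q y k) • x ^ k := by
  induction N with
  | zero => simp [qBinom_self hq]
  | succ N ih =>
    rw [prod_range_succ, ih, mul_sub, mul_one, sum_range_succ' _ (N + 1), sum_mul]
    have h1 : ∑ k ∈ range (N + 1), (qBinom q N k * thetaTerm q y k) • x ^ k =
        ∑ k ∈ range (N + 1), (qBinom q N (k + 1) * thetaTerm q y (k + 1)) • x ^ (k + 1) + 1 := by
      have h := sum_range_succ' (fun k => (qBinom q N k * thetaTerm q y k) • x ^ k) (N + 1)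
      rw [sum_range_succ, qBinom_of_lt q (Nat.lt_succ_self N)] at h
      simpa [qBinom_zero_right hq] using h
    rw [h1, add_sub_right_comm, ← sum_sub_distrib, qBinom_zero_right hq]
    simp only [thetaTerm_zero, pow_zero, mul_one, one_smul]
    congr 1
    refine sum_congr rfl fun k hk => ?_
    have hk' : k ≤ N := Nat.lt_succ_iff.1 (mem_range.1 hk)
    rw [qBinom_succ_succ hq hk', smul_mul_smul_comm, ← pow_succ, ← sub_smul, thetaTerm_succ]
    congr 1
    have : q ^ N = q ^ k * q ^ (N - k) := by rw [← pow_add, Nat.add_sub_cancel' hk']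
    rw [this]
    ring

theorem qPoch_eq_sum {q : ℂ} (hq : ‖q‖ < 1) (x : ℂ) (N : ℕ) :
    qPoch x q N = ∑ k ∈ range (N + 1), qBinom q N k * thetaTerm q x k := by
  simpa [qPoch] using prod_one_sub_smul hq x (1 : ℂ) N

/-! ### Formal series for (yX; q)_N and 1/(X; q)_{R+1}. -/

/-- The product `(y X; q)_N` as a formal power series. -/
noncomputable def pochSeries (q y : ℂ) (N : ℕ) : PowerSeries ℂ :=
  ∏ i ∈ range N, (1 - (y * q ^ i) • (PowerSeries.X : PowerSeries ℂ))

theorem pochSeries_add (q y : ℂ) (m n : ℕ) :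
    pochSeries q y (m + n) = pochSeries q y m * pochSeries q (y * q ^ m) n := by
  simp only [pochSeries, prod_range_add]
  congr 1
  exact prod_congr rfl fun i _ => by rw [pow_add, mul_assoc]

/-- The formal power series `1 / (X; q)_{R+1}`. -/
noncomputable def invPochSeries (q : ℂ) (R : ℕ) : PowerSeries ℂ :=
  PowerSeries.mk fun s => qPoch q q (R + s) / (qPoch q q R * qPoch q q s)

/-- Coefficient by coefficient this is the q-Pascal rule. -/
theorem invPochSeries_succ_mul {q : ℂ} (hq : ‖q‖ < 1) (R : ℕ) :
    invPochSeries q (R + 1) * (1 - (1 * q ^ (R + 1)) • (PowerSeries.X : PowerSeries ℂ)) =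
      invPochSeries q R := by
  ext s
  rw [mul_sub, mul_one, mul_smul_comm, map_sub, PowerSeries.coeff_smul]
  rcases s with _ | s
  · simp [invPochSeries, qPoch_self_ne_zero hq]
  · simp only [PowerSeries.coeff_succ_mul_X, invPochSeries, PowerSeries.coeff_mk]
    have h1 := qPoch_self_ne_zero hq R
    have h2 := qPoch_self_ne_zero hq s
    have h3 : 1 - q * q ^ R ≠ 0 := sub_ne_zero.2 (mul_pow_self_ne_one hq R).symm
    have h4 : 1 - q * q ^ s ≠ 0 := sub_ne_zero.2 (mul_pow_self_ne_one hq s).symm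
    have e1 : R + 1 + (s + 1) = R + s + 1 + 1 := by ring
    have e2 : R + 1 + s = R + s + 1 := by ring
    have e3 : R + (s + 1) = R + s + 1 := by ring
    rw [e1, e2, e3, qPoch_succ q q (R + s + 1), qPoch_succ q q R, qPoch_succ q q s]
    have e4 : 1 - q * q ^ (R + s + 1) = (1 - q * q ^ R) + q ^ (R + 1) * (1 - q * q ^ s) := by ring
    rw [e4, smul_eq_mul, one_mul]
    generalize 1 - q * q ^ R = u at h3 ⊢
    generalize 1 - q * q ^ s = v at h4 ⊢
    field_simp
    ring

theorem invPochSeries_mul_pochSeries {q : ℂ} (hq : ‖q‖ < 1) (R : ℕ) :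
    invPochSeries q R * pochSeries q 1 (R + 1) = 1 := by
  induction R with
  | zero =>
    ext s
    simp only [pochSeries, invPochSeries, zero_add, prod_range_one, pow_zero, mul_one, one_smul,
      mul_sub, map_sub, qPoch_zero, one_mul, div_self (qPoch_self_ne_zero hq _)]
    rcases s with _ | s
    · simp
    · simp [PowerSeries.coeff_succ_mul_X, PowerSeries.coeff_one]
  | succ R ih =>
    rw [pochSeries, prod_range_succ, mul_comm (∏ i ∈ range (R + 1), _), ← mul_assoc,
      invPochSeries_succ_mul hq]
    exact ih

/-- The numerator is (yX; q)_{R+M+1}. Because y q^M = 1, its factors from index M on are exactly (X;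
q)_{R+1}, which cancels the denominator and with it all dependence on R. -/
theorem pochSeries_mul_invPochSeries {q y : ℂ} (hq : ‖q‖ < 1) {M : ℕ} (hy : y * q ^ M = 1)
    (R : ℕ) :
    pochSeries q (y * q ^ R) (M + 1) * (pochSeries q y R * invPochSeries q R) =
      pochSeries q y M := by
  have h : pochSeries q y R * pochSeries q (y * q ^ R) (M + 1) =
      pochSeries q y M * pochSeries q 1 (R + 1) := by
    rw [← pochSeries_add, ← hy, ← pochSeries_add]
    congr 1
    ring
  calc _ = (pochSeries q y R * pochSeries q (y * q ^ R) (M + 1)) * invPochSeries q R := by ring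
    _ = pochSeries q y M * (invPochSeries q R * pochSeries q 1 (R + 1)) := by rw [h]; ring
    _ = _ := by rw [invPochSeries_mul_pochSeries hq, mul_one]

/-! ### The partial theta pairing. -/

/-- The pairing `∑_T (-1)^T q^{T(T-1)/2} b^T p_T` of a power series `p` with the partial theta
function converges to `v`. -/
def HasPairing (q b : ℂ) (p : PowerSeries ℂ) (v : ℂ) : Prop :=
  HasSum (fun T => thetaTerm q b T * PowerSeries.coeff T p) v

/-- The quadratic exponent obeys C(k+s, 2) = C(k, 2) + C(s, 2) + ks, and the cross term q^(ks) is
the shift b ↦ b q^k. -/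
theorem HasPairing.X_pow_mul {q b : ℂ} {p : PowerSeries ℂ} {v : ℂ} (k : ℕ)
    (h : HasPairing q (b * q ^ k) p v) :
    HasPairing q b (PowerSeries.X ^ k * p) (thetaTerm q b k * v) := by
  unfold HasPairing at h ⊢
  refine (hasSum_nat_add_iff' k).1 ?_
  have h0 : ∑ i ∈ range k,
      thetaTerm q b i * PowerSeries.coeff i (PowerSeries.X ^ k * p) = 0 :=
    sum_eq_zero fun i hi => by
      rw [PowerSeries.coeff_X_pow_mul', if_neg (mem_range.1 hi).not_ge, mul_zero]
  rw [h0, sub_zero]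
  refine (h.mul_left (thetaTerm q b k)).congr_fun ?_
  intro s
  rw [PowerSeries.coeff_X_pow_mul, thetaTerm_add, thetaTerm_mul, ← pow_mul]
  ring

theorem HasPairing.smul {q b : ℂ} {p : PowerSeries ℂ} {v : ℂ} (c : ℂ) (h : HasPairing q b p v) :
    HasPairing q b (c • p) (c * v) := by
  unfold HasPairing at h ⊢
  simpa only [PowerSeries.coeff_smul, smul_eq_mul, mul_left_comm] using h.mul_left c

theorem HasPairing.sum {q b : ℂ} {ι : Type*} {s : Finset ι} {p : ι → PowerSeries ℂ} {v : ι → ℂ}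
    (h : ∀ i ∈ s, HasPairing q b (p i) (v i)) :
    HasPairing q b (∑ i ∈ s, p i) (∑ i ∈ s, v i) := by
  unfold HasPairing at h ⊢
  simpa only [map_sum, mul_sum] using hasSum_sum h

theorem HasPairing.pochSeries_mul {q b y : ℂ} (hq : ‖q‖ < 1) {p : PowerSeries ℂ} {v : ℕ → ℂ}
    {N : ℕ} (h : ∀ k ≤ N, HasPairing q (b * q ^ k) p (v k)) :
    HasPairing q b (pochSeries q y N * p)
      (∑ k ∈ range (N + 1), qBinom q N k * thetaTerm q y k * (thetaTerm q b k * v k)) := by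
  rw [pochSeries, prod_one_sub_smul hq, sum_mul]
  refine HasPairing.sum fun k hk => ?_
  rw [smul_mul_assoc]
  exact ((h k (Nat.lt_succ_iff.1 (mem_range.1 hk))).X_pow_mul k).smul _

theorem hasPairing_one (q b : ℂ) : HasPairing q b 1 1 := by
  unfold HasPairing
  convert hasSum_ite_eq (0 : ℕ) (1 : ℂ) using 2 with T
  by_cases h : T = 0 <;> simp [PowerSeries.coeff_one, h]

theorem hasPairing_pochSeries {q : ℂ} (hq : ‖q‖ < 1) (b y : ℂ) (N : ℕ) :
    HasPairing q b (pochSeries q y N)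
      (∑ k ∈ range (N + 1), qBinom q N k * thetaTerm q y k * thetaTerm q b k) := by
  simpa using HasPairing.pochSeries_mul hq (y := y) (N := N) (p := 1) (v := fun _ => 1)
    fun k _ => hasPairing_one q (b * q ^ k)

/-! ### The finite Rogers–Ramanujan type identity and the evaluation of Q. -/

/-- The summand of the very-well-poised side of the finite Rogers–Ramanujan type identity. -/
noncomputable def wellPoisedTerm (q b : ℂ) (M i : ℕ) : ℂ :=
  (-1) ^ i * q ^ (i.choose 2 + 2 * i ^ 2) * b ^ (2 * i) * qBinom q M i * (1 - b * q ^ (2 * i)) /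
    qPoch (b * q ^ i) q (M + 1)

theorem sum_qBinom_succ_mul {q : ℂ} (hq : ‖q‖ < 1) (M : ℕ) (f : ℕ → ℂ) :
    ∑ i ∈ range (M + 2), qBinom q (M + 1) i * f i =
      ∑ i ∈ range (M + 1), (qBinom q M i * f i + q ^ (M - i) * qBinom q M i * f (i + 1)) := by
  have h := sum_range_succ' (fun i => qBinom q M i * f i) (M + 1)
  rw [sum_range_succ, qBinom_of_lt q (Nat.lt_succ_self M), zero_mul, add_zero] at h
  rw [sum_add_distrib, h, sum_range_succ', qBinom_zero_right hq, qBinom_zero_right hq,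
    add_right_comm, ← sum_add_distrib]
  congr 1
  refine sum_congr rfl fun i hi => ?_
  rw [qBinom_succ_succ hq (Nat.lt_succ_iff.1 (mem_range.1 hi)), add_mul]

/-- The recurrence S_{M+1}(b) = S_M(b) + b q^(M+1) S_M(bq) also holds for the other side of the
identity, by q-Pascal, so it drives the induction on M. -/
theorem sum_wellPoisedTerm_succ {q b : ℂ} (hq : ‖q‖ < 1) (hb : ∀ n : ℕ, b * q ^ n ≠ 1) (M : ℕ) :
    ∑ i ∈ range (M + 2), wellPoisedTerm q b (M + 1) i =
      ∑ i ∈ range (M + 1), wellPoisedTerm q b M i +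
        b * q ^ (M + 1) * ∑ i ∈ range (M + 1), wellPoisedTerm q (b * q) M i := by
  have hv : ∀ n, 1 - b * q ^ n ≠ 0 := fun n => sub_ne_zero.2 (hb n).symm
  have hD : ∀ i, qPoch (b * q ^ i) q (M + 1) ≠ 0 := fun i =>
    qPoch_ne_zero (fun n => by rw [mul_assoc, ← pow_add]; exact hb _) _
  set c : ℕ → ℂ := fun i => (-1) ^ i * q ^ (i.choose 2 + 2 * i ^ 2) * b ^ (2 * i) with hc
  have hsplit : ∀ i ∈ range (M + 2), wellPoisedTerm q b (M + 1) i =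
      qBinom q (M + 1) i * (c i / qPoch (b * q ^ i) q (M + 1)) -
        c i * b * q ^ (2 * i) * (qBinom q (M + 1) i * (1 - q ^ (M + 1 - i))) /
          (qPoch (b * q ^ i) q (M + 1) * (1 - b * q ^ (i + (M + 1)))) := by
    intro i hi
    have hi' : i ≤ M + 1 := Nat.lt_succ_iff.1 (mem_range.1 hi)
    -- This splitting makes one part lose the last factor of its denominator, while the other gains
    -- 1 - q^(M+1-i), which lowers the Gaussian binomial and vanishes at i = M + 1.
    have h1 : 1 - b * q ^ (2 * i) =
        (1 - b * q ^ (i + (M + 1))) - b * q ^ (2 * i) * (1 - q ^ (M + 1 - i)) := by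
      have : q ^ (i + (M + 1)) = q ^ (2 * i) * q ^ (M + 1 - i) := by
        rw [← pow_add]; congr 1; omega
      rw [this]; ring
    rw [wellPoisedTerm, h1, qPoch_succ _ q (M + 1),
      show b * q ^ i * q ^ (M + 1) = b * q ^ (i + (M + 1)) by ring]
    have h2 := hD i
    have h3 := hv (i + (M + 1))
    generalize 1 - b * q ^ (i + (M + 1)) = v at h3 ⊢
    simp only [hc]
    field_simp
  rw [sum_congr rfl hsplit, sum_sub_distrib, sum_qBinom_succ_mul hq, sum_range_succ _ (M + 1),
    Nat.sub_self, pow_zero, sub_self, mul_zero, mul_zero, zero_div, add_zero, ← sum_sub_distrib,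
    mul_sum, ← sum_add_distrib]
  refine sum_congr rfl fun i hi => ?_
  have hi' : i ≤ M := Nat.lt_succ_iff.1 (mem_range.1 hi)
  rw [qBinom_mul_one_sub hq hi', wellPoisedTerm, wellPoisedTerm]
  -- All denominators reduce to (b q^(i+1); q)_{M+1} and two linear factors; what remains is a
  -- rational identity in q^i and q^(M-i).
  have hDD : qPoch (b * q ^ i) q (M + 1) * (1 - b * q ^ (i + (M + 1))) =
      (1 - b * q ^ i) * qPoch (b * q ^ (i + 1)) q (M + 1) := by
    rw [pow_add, ← mul_assoc b, ← qPoch_succ, qPoch_succ', mul_assoc b, ← pow_succ]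
  have hDi : qPoch (b * q ^ i) q (M + 1) =
      (1 - b * q ^ i) * qPoch (b * q ^ (i + 1)) q (M + 1) / (1 - b * q ^ (i + (M + 1))) :=
    eq_div_of_mul_eq (hv _) hDD
  have hc1 : c (i + 1) = -(c i * q ^ (5 * i + 2) * b ^ 2) := by
    simp only [hc, choose_two_succ]
    ring
  have hbq : b * q * q ^ i = b * q ^ (i + 1) := by ring
  have hci : (-1) ^ i * q ^ (i.choose 2 + 2 * i ^ 2) * (b * q) ^ (2 * i) = c i * q ^ (2 * i) := by
    simp only [hc]; ring
  have hci' : (-1) ^ i * q ^ (i.choose 2 + 2 * i ^ 2) * b ^ (2 * i) = c i := rfl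
  have hM : q ^ M = q ^ i * q ^ (M - i) := by rw [← pow_add, Nat.add_sub_cancel' hi']
  have hvq : 1 - b * q ^ (i + (M + 1)) = 1 - b * (q ^ i * (q * (q ^ i * q ^ (M - i)))) := by
    rw [← hM]; ring
  rw [hDD, hDi, hc1, hbq, hci, hci']
  have h2 := hD (i + 1)
  have h3 := hv (i + (M + 1))
  have h4 := hv i
  rw [hvq] at h3 ⊢
  rw [pow_succ q M, hM]
  generalize qPoch (b * q ^ (i + 1)) q (M + 1) = E at h2 ⊢
  generalize q ^ (M - i) = z at h3 ⊢
  generalize qBinom q M i = g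
  generalize c i = d
  have e1 : q ^ (2 * i) = (q ^ i) ^ 2 := by rw [← pow_mul, mul_comm]
  have e2 : q ^ (5 * i + 2) = (q ^ i) ^ 5 * q ^ 2 := by rw [pow_add, ← pow_mul, mul_comm i]
  rw [e1, e2]
  generalize q ^ i = x at h3 h4 ⊢
  field_simp
  ring

theorem sum_wellPoisedTerm {q b : ℂ} (hq : ‖q‖ < 1) (hb : ∀ n : ℕ, b * q ^ n ≠ 1) (M : ℕ) :
    ∑ i ∈ range (M + 1), wellPoisedTerm q b M i =
      ∑ T ∈ range (M + 1), qBinom q M T * (q ^ (T ^ 2) * b ^ T) := by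
  induction M generalizing b with
  | zero =>
    have h : 1 - b ≠ 0 := sub_ne_zero.2 (by simpa using (hb 0).symm)
    simp [wellPoisedTerm, qBinom_self hq, qPoch, h]
  | succ M ih =>
    rw [sum_wellPoisedTerm_succ hq hb, ih hb,
      ih fun n => by rw [mul_assoc, ← pow_succ']; exact hb _, sum_qBinom_succ_mul hq, mul_sum,
      ← sum_add_distrib]
    refine sum_congr rfl fun T hT => ?_
    have hT' : T ≤ M := Nat.lt_succ_iff.1 (mem_range.1 hT)
    have hM : q ^ M = q ^ T * q ^ (M - T) := by rw [← pow_add, Nat.add_sub_cancel' hT']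
    rw [pow_succ q M, hM]
    ring

/-- Each factor 1 - q^(i-M), multiplied by q^M, becomes -q^i (1 - q^(M-i)). -/
theorem qPoch_inv_pow {q : ℂ} (hq0 : q ≠ 0) (hq : ‖q‖ < 1) {M i : ℕ} (hi : i ≤ M) :
    qPoch (q ^ M)⁻¹ q i * (q ^ M) ^ i =
      (-1) ^ i * q ^ (i.choose 2) * (qBinom q M i * qPoch q q i) := by
  have key : ∀ i ≤ M, qPoch (q ^ M)⁻¹ q i * (q ^ M) ^ i * qPoch q q (M - i) =
      (-1) ^ i * q ^ (i.choose 2) * qPoch q q M := by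
    intro i
    induction i with
    | zero => simp
    | succ i ih =>
      intro hi
      have h := ih (by omega)
      have e : M - i = (M - (i + 1)) + 1 := by omega
      have hM : q ^ M = q ^ i * (q * q ^ (M - (i + 1))) := by
        rw [← pow_succ', ← pow_add]; congr 1; omega
      have h1 : (1 - (q ^ M)⁻¹ * q ^ i) * q ^ M = -q ^ i * (1 - q * q ^ (M - (i + 1))) := by
        rw [sub_mul, mul_right_comm, inv_mul_cancel₀ (pow_ne_zero _ hq0), hM]; ring
      rw [e, qPoch_succ] at h
      rw [qPoch_succ, choose_two_succ, pow_succ (q ^ M)]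
      calc _ = qPoch (q ^ M)⁻¹ q i * (q ^ M) ^ i * qPoch q q (M - (i + 1)) *
            ((1 - (q ^ M)⁻¹ * q ^ i) * q ^ M) := by ring
        _ = -q ^ i * (qPoch (q ^ M)⁻¹ q i * (q ^ M) ^ i *
            (qPoch q q (M - (i + 1)) * (1 - q * q ^ (M - (i + 1))))) := by rw [h1]; ring
        _ = _ := by rw [h]; ring
  have h := key i hi
  obtain ⟨l, rfl⟩ := Nat.exists_eq_add_of_le hi
  have h1 := qPoch_self_ne_zero hq i
  have h2 := qPoch_self_ne_zero hq l
  rw [Nat.add_sub_cancel_left] at h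
  rw [qBinom_add, eq_div_of_mul_eq h2 h]
  field_simp

theorem Q_eq_sum_wellPoisedTerm {q : ℂ} (hq0 : q ≠ 0) (hq : ‖q‖ < 1) (b : ℂ) (M : ℕ) :
    Q q (M + 2) b = ∑ i ∈ range (M + 1), wellPoisedTerm q b M i := by
  refine sum_congr rfl fun i hi => ?_
  have hi' : i ≤ M := Nat.lt_succ_iff.1 (mem_range.1 hi)
  have e1 : q ^ (2 - ((M + 2 : ℕ) : ℤ)) = (q ^ M)⁻¹ := by
    rw [← zpow_natCast, ← zpow_neg]; congr 1; push_cast; ring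
  have e2 : q ^ ((2 * (i : ℤ) - 2 + ((M + 2 : ℕ) : ℤ)) * (i : ℤ)) =
      q ^ (2 * i ^ 2) * (q ^ M) ^ i := by
    rw [← pow_mul, ← pow_add, ← zpow_natCast]; congr 1; push_cast; ring
  have h := qPoch_inv_pow hq0 hq hi'
  have h1 := qPoch_self_ne_zero hq i
  rw [wellPoisedTerm, e1, e2, show M + 2 - 1 = M + 1 by omega]
  calc _ = (qPoch (q ^ M)⁻¹ q i * (q ^ M) ^ i) / qPoch q q i *
        ((1 - b * q ^ (2 * i)) * b ^ (2 * i) * q ^ (2 * i ^ 2) /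
          qPoch (b * q ^ i) q (M + 1)) := by
        field_simp
    _ = _ := by
        rw [h, mul_div_assoc, mul_div_cancel_right₀ _ h1]
        ring

theorem sq_eq_choose_two (n : ℕ) : n ^ 2 = n.choose 2 + n.choose 2 + n := by
  induction n with
  | zero => rfl
  | succ n ih => rw [choose_two_succ, add_sq, ih]; ring

/-- With T² = 2 C(T, 2) + T, the sum side at b q^(-M-1) becomes the pairing of (yX; q)_M, y =
q^(-M). -/
theorem Q_mul_zpow {q b : ℂ} (hq0 : q ≠ 0) (hq : ‖q‖ < 1) (M : ℕ)
    (hb : ∀ n : ℕ, b * q ^ n ≠ q ^ (M + 1)) :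
    Q q (M + 2) (b * q ^ (1 - ((M + 2 : ℕ) : ℤ))) =
      ∑ T ∈ range (M + 1), qBinom q M T * thetaTerm q (q ^ M)⁻¹ T * thetaTerm q b T := by
  have e1 : q ^ (1 - ((M + 2 : ℕ) : ℤ)) = (q ^ (M + 1))⁻¹ := by
    rw [← zpow_natCast, ← zpow_neg]; congr 1
  have hM : q ^ (M + 1) ≠ 0 := pow_ne_zero _ hq0
  rw [e1, Q_eq_sum_wellPoisedTerm hq0 hq, sum_wellPoisedTerm hq]
  · refine sum_congr rfl fun T _ => ?_
    rw [mul_assoc]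
    congr 1
    have h1 := sq_eq_choose_two T
    have h2 : ((-1 : ℂ) ^ T) * (-1) ^ T = 1 := by rw [← mul_pow]; simp
    simp only [thetaTerm]
    calc q ^ T ^ 2 * (b * (q ^ (M + 1))⁻¹) ^ T
        = q ^ T.choose 2 * q ^ T.choose 2 * b ^ T * (q * (q ^ (M + 1))⁻¹) ^ T := by
          rw [h1, pow_add, pow_add]; ring
      _ = q ^ T.choose 2 * q ^ T.choose 2 * b ^ T * ((q ^ M)⁻¹) ^ T := by
          congr 2
          rw [pow_succ']
          field_simp
      _ = (((-1 : ℂ) ^ T) * (-1) ^ T) *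
          (q ^ T.choose 2 * q ^ T.choose 2 * b ^ T * ((q ^ M)⁻¹) ^ T) := by rw [h2, one_mul]
      _ = _ := by ring
  · intro n h
    refine hb n ?_
    field_simp at h
    exact h

/-! ### Two ways of summing the quadruple series. -/

theorem hasSum_sum_range_of_prod {g : ℕ × ℕ → ℂ} {S : ℂ} (h : HasSum g S) :
    HasSum (fun n => ∑ j ∈ range (n + 1), g (j, n - j)) S := by
  have h1 := (Finset.HasAntidiagonal.sigmaAntidiagonalEquivProd (A := ℕ)).hasSum_iff.2 h
  have h2 := h1.sigma fun n => hasSum_fintype _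
  refine h2.congr_fun fun n => ?_
  rw [← Finset.Nat.sum_antidiagonal_eq_sum_range_succ_mk, ← Finset.sum_coe_sort]
  rfl

/-- The coefficients of 1/(X; q)_{R+1} converge, hence are bounded, and the theta terms are
absolutely summable. -/
theorem summable_thetaTerm_mul_coeff {q : ℂ} (hq : ‖q‖ < 1) (b : ℂ) (R : ℕ) :
    Summable fun s => thetaTerm q b s * PowerSeries.coeff s (invPochSeries q R) := by
  have h1 : Tendsto (fun s => qPoch q q (R + s)) atTop (𝓝 (qPochInf q q)) := by
    simp only [add_comm R]
    exact (tendsto_add_atTop_iff_nat R).2 (tendsto_qPoch q hq)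
  have h2 := (h1.div ((tendsto_qPoch q hq).const_mul (qPoch q q R))
    (mul_ne_zero (qPoch_self_ne_zero hq R)
      (qPochInf_ne_zero hq (mul_pow_self_ne_one hq)))).isBigO_one ℂ
  refine summable_of_isBigO_nat (summable_norm_thetaTerm hq b) ?_
  simpa [invPochSeries] using ((Asymptotics.isBigO_refl (thetaTerm q b) atTop).mul h2).norm_right

/-- The value of the pairing of `(y X; q)_R / (X; q)_{R+1}` with the partial theta function. -/
noncomputable def pairingValue (q y b : ℂ) (R : ℕ) : ℂ :=
  ∑ j ∈ range (R + 1), qBinom q R j * thetaTerm q y j * (thetaTerm q b j *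
    ∑' s, thetaTerm q (b * q ^ j) s * PowerSeries.coeff s (invPochSeries q R))

theorem hasPairing_pairingValue {q : ℂ} (hq : ‖q‖ < 1) (y b : ℂ) (R : ℕ) :
    HasPairing q b (pochSeries q y R * invPochSeries q R) (pairingValue q y b R) :=
  HasPairing.pochSeries_mul hq fun _ _ => (summable_thetaTerm_mul_coeff hq _ R).hasSum

/-- The quadruple series interpolating between the two expansions of `P`, with the indices
grouped as `((j, l), (r, s))`. -/
noncomputable def quadTerm (q a b z : ℂ) (i : (ℕ × ℕ) × (ℕ × ℕ)) : ℂ :=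
  qPochInf q q * (q ^ (i.1.1 + i.1.2)) ^ (1 + i.1.1 + i.2.1 + i.2.2) *
    (thetaTerm q z i.1.1 / qPoch q q i.1.1 / qPoch q q i.1.2) *
    (thetaTerm q a i.2.1 / qPoch q q i.2.1 * (thetaTerm q b i.2.2 / qPoch q q i.2.2))

theorem summable_norm_thetaTerm_div {q : ℂ} (hq : ‖q‖ < 1) (x : ℂ) :
    Summable fun n => ‖thetaTerm q x n / qPoch q q n‖ :=
  summable_norm_div_qPoch_self hq (summable_norm_thetaTerm hq x)

theorem summable_quadTerm {q : ℂ} (hq : ‖q‖ < 1) (a b z : ℂ) :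
    Summable (quadTerm q a b z) := by
  have hθ := summable_norm_thetaTerm_div hq
  have hl : Summable fun n => ‖q ^ n / qPoch q q n‖ := summable_norm_div_qPoch_self hq <| by
    simpa only [norm_pow] using summable_geometric_of_lt_one (norm_nonneg q) hq
  have h := (((hθ z).mul_norm hl).mul_norm ((hθ a).mul_norm (hθ b))).mul_left ‖qPochInf q q‖
  refine Summable.of_norm_bounded h ?_
  rintro ⟨⟨j, l⟩, ⟨r, s⟩⟩
  simp only [quadTerm, norm_mul, norm_div, norm_pow, mul_assoc]
  refine mul_le_mul_of_nonneg_left ?_ (norm_nonneg _)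
  -- Since (j + l)(1 + j + r + s) ≥ l, one factor q^l survives to make the sum over l geometric; the
  -- theta terms handle j, r and s.
  have hp : (‖q‖ ^ (j + l)) ^ (1 + j + r + s) ≤ ‖q‖ ^ l := by
    rw [← pow_mul]
    exact pow_le_pow_of_le_one (norm_nonneg _) hq.le (by nlinarith [Nat.zero_le (j + l)])
  calc _ ≤ ‖q‖ ^ l * _ := mul_le_mul_of_nonneg_right hp (by positivity)
    _ = _ := by ring

theorem hasSum_qPochInf_mul {q : ℂ} (hq : ‖q‖ < 1) (x y : ℂ) :
    HasSum (fun p : ℕ × ℕ => thetaTerm q x p.1 / qPoch q q p.1 *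
      (thetaTerm q y p.2 / qPoch q q p.2)) (qPochInf x q * qPochInf y q) := by
  have hs := summable_mul_of_summable_norm (summable_norm_thetaTerm_div hq x)
    (summable_norm_thetaTerm_div hq y)
  have h := (hasSum_qPochInf hq x).mul (hasSum_qPochInf hq y) hs
  exact h

theorem hasSum_quadTerm_right {q : ℂ} (hq : ‖q‖ < 1) (a b z : ℂ) (j l : ℕ) :
    HasSum (fun p : ℕ × ℕ => quadTerm q a b z ((j, l), p))
      (qPochInf q q * (q ^ (j + l)) ^ (1 + j) * (thetaTerm q z j / qPoch q q j / qPoch q q l) *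
        (qPochInf (a * q ^ (j + l)) q * qPochInf (b * q ^ (j + l)) q)) := by
  have h := (hasSum_qPochInf_mul hq (a * q ^ (j + l)) (b * q ^ (j + l))).mul_left
    (qPochInf q q * (q ^ (j + l)) ^ (1 + j) * (thetaTerm q z j / qPoch q q j / qPoch q q l))
  refine h.congr_fun fun p => ?_
  rw [quadTerm, thetaTerm_mul, thetaTerm_mul]
  generalize q ^ (j + l) = x
  rw [pow_add _ _ p.2, pow_add _ _ p.1]
  ring

/-- Summing over r and s gives (aq^n; q)_∞ (bq^n; q)_∞ with n = j + l. On each diagonal the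
q-binomial theorem then assembles (zq^n; q)_n = (z; q)_{2n} / (z; q)_n. -/
theorem hasSum_mul_PTerm {q a b : ℂ} {m : ℕ} (hq : ‖q‖ < 1) (ha : ∀ n : ℕ, a * q ^ n ≠ 1)
    (hb : ∀ n : ℕ, b * q ^ n ≠ 1) (hab : ∀ n : ℕ, a * b / q ^ m * q ^ n ≠ 1) :
    HasSum (fun n => qPochInf q q * qPochInf a q * qPochInf b q * PTerm q m a b n)
      (∑' i, quadTerm q a b (a * b / q ^ m) i) := by
  have h := (summable_quadTerm hq a b (a * b / q ^ m)).hasSum.prod_fiberwise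
    fun p => hasSum_quadTerm_right hq a b (a * b / q ^ m) p.1 p.2
  refine (hasSum_sum_range_of_prod h).congr_fun fun n => ?_
  have h1 := qPoch_self_ne_zero hq n
  have h2 := qPoch_ne_zero ha n
  have h3 := qPoch_ne_zero hb n
  have h4 := qPoch_ne_zero hab n
  simp only [PTerm]
  generalize a * b / q ^ m = z at h4 ⊢
  rw [two_mul, qPoch_add, ← qPoch_mul_qPochInf a hq n, ← qPoch_mul_qPochInf b hq n,
    qPoch_eq_sum hq (z * q ^ n)]
  have h5 : ∀ j ∈ range (n + 1), qPochInf q q * (q ^ (j + (n - j))) ^ (1 + j) *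
      (thetaTerm q z j / qPoch q q j / qPoch q q (n - j)) *
        (qPochInf (a * q ^ (j + (n - j))) q * qPochInf (b * q ^ (j + (n - j))) q) =
      (qPochInf q q * qPochInf (a * q ^ n) q * qPochInf (b * q ^ n) q * q ^ n / qPoch q q n) *
        (qBinom q n j * thetaTerm q (z * q ^ n) j) := by
    intro j hj
    have hj' : j ≤ n := Nat.lt_succ_iff.1 (mem_range.1 hj)
    rw [Nat.add_sub_cancel' hj', qBinom, if_pos hj', thetaTerm_mul, pow_add _ 1 j, pow_one]
    field_simp
  rw [sum_congr rfl h5, ← mul_sum]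
  field_simp

/-- The factor q^(j²+j) is q^(2 C(j, 2)) q^(2j): the first part supplies two more theta exponents,
and the second turns z into z q² = aby. -/
theorem thetaTerm_mul_thetaTerm_mul {q a b y z : ℂ} (hz : z * q ^ 2 = a * b * y) (j r s : ℕ) :
    (q ^ j) ^ (1 + j + r + s) * thetaTerm q z j * (thetaTerm q a r * thetaTerm q b s) =
      thetaTerm q a (j + r) * thetaTerm q y j * thetaTerm q b j * thetaTerm q (b * q ^ j) s := by
  rw [thetaTerm_add, thetaTerm_mul]
  have h : thetaTerm q z j * (q ^ j) ^ (1 + j) =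
      thetaTerm q a j * thetaTerm q b j * thetaTerm q y j := by
    have h1 : ((-1 : ℂ) ^ j) * (-1) ^ j = 1 := by rw [← mul_pow]; simp
    simp only [thetaTerm]
    calc _ = (-1) ^ j * q ^ j.choose 2 * z ^ j * q ^ (j ^ 2 + j) := by ring
      _ = (-1) ^ j * q ^ j.choose 2 * (q ^ j.choose 2 * q ^ j.choose 2) * (z * q ^ 2) ^ j := by
        rw [sq_eq_choose_two]; ring
      _ = (-1) ^ j * q ^ j.choose 2 * (q ^ j.choose 2 * q ^ j.choose 2) *
          (a * b * y) ^ j * ((-1) ^ j * (-1) ^ j) := by rw [hz, h1, mul_one]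
      _ = _ := by ring
  calc _ = (thetaTerm q z j * (q ^ j) ^ (1 + j)) * (q ^ j) ^ (r + s) *
        (thetaTerm q a r * thetaTerm q b s) := by ring
    _ = _ := by rw [h]; ring

/-- Here l is summed first, giving (q; q)_{j+r+s}, the numerator of a coefficient of 1/(X; q)_{R+1}
with R = j + r. The sum over s is then a pairing, and the diagonals j + r = R collect the expansion
of (yX; q)_R. -/
theorem hasSum_thetaTerm_mul_pairingValue {q a b y z : ℂ} (hq : ‖q‖ < 1)
    (hz : z * q ^ 2 = a * b * y) :
    HasSum (fun R => thetaTerm q a R * pairingValue q y b R) (∑' i, quadTerm q a b z i) := by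
  have hs := (Equiv.prodProdProdComm ℕ ℕ ℕ ℕ).summable_iff.2 (summable_quadTerm hq a b z)
  have hsum := (Equiv.prodProdProdComm ℕ ℕ ℕ ℕ).hasSum_iff.2 (summable_quadTerm hq a b z).hasSum
  have hfib : ∀ p : ℕ × ℕ,
      HasSum (fun c : ℕ × ℕ => (quadTerm q a b z ∘ Equiv.prodProdProdComm ℕ ℕ ℕ ℕ) (p, c))
        (thetaTerm q a (p.1 + p.2) * (qBinom q (p.1 + p.2) p.1 * thetaTerm q y p.1 *
          (thetaTerm q b p.1 * ∑' s, thetaTerm q (b * q ^ p.1) s *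
            PowerSeries.coeff s (invPochSeries q (p.1 + p.2))))) := by
    rintro ⟨j, r⟩
    have h1 := (hs.prod_factor (j, r)).hasSum
    have h2 := ((Equiv.prodComm ℕ ℕ).hasSum_iff.2 h1).prod_fiberwise
      (g := fun s => thetaTerm q a (j + r) * (qBinom q (j + r) j * thetaTerm q y j *
        (thetaTerm q b j * (thetaTerm q (b * q ^ j) s *
            PowerSeries.coeff s (invPochSeries q (j + r)))))) fun s => by
      have h3 := (hasSum_qPoch_self hq (j + r + s)).mul_left ((q ^ j) ^ (1 + j + r + s) *
        (thetaTerm q z j / qPoch q q j) *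
        (thetaTerm q a r / qPoch q q r * (thetaTerm q b s / qPoch q q s)))
      have h4 := qPoch_self_ne_zero hq (j + r)
      have hval : (q ^ j) ^ (1 + j + r + s) * (thetaTerm q z j / qPoch q q j) *
          (thetaTerm q a r / qPoch q q r * (thetaTerm q b s / qPoch q q s)) *
            qPoch q q (j + r + s) =
          thetaTerm q a (j + r) * (qBinom q (j + r) j * thetaTerm q y j *
            (thetaTerm q b j * (thetaTerm q (b * q ^ j) s *
              PowerSeries.coeff s (invPochSeries q (j + r))))) := by
        rw [invPochSeries, PowerSeries.coeff_mk, qBinom_add]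
        calc _ = ((q ^ j) ^ (1 + j + r + s) * thetaTerm q z j *
                (thetaTerm q a r * thetaTerm q b s)) * qPoch q q (j + r + s) /
                (qPoch q q j * qPoch q q r * qPoch q q s) := by field_simp
          _ = _ := by
            rw [thetaTerm_mul_thetaTerm_mul hz]
            field_simp
      rw [hval] at h3
      refine h3.congr_fun fun l => ?_
      simp only [Function.comp, Equiv.prodComm_apply, Prod.swap, Equiv.prodProdProdComm_apply,
        quadTerm]
      rw [pow_add q j l, mul_pow, ← pow_mul q l, mul_comm l, pow_mul,
        show 1 + j + r + s = j + r + s + 1 by ring]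
      ring
    have h5 := h2.tsum_eq
    simp only [tsum_mul_left] at h5
    rw [h5]
    exact h1
  refine (hasSum_sum_range_of_prod (hsum.prod_fiberwise hfib)).congr_fun fun R => ?_
  rw [pairingValue, mul_sum]
  refine sum_congr rfl fun j hj => ?_
  simp only [Nat.add_sub_cancel' (Nat.lt_succ_iff.1 (mem_range.1 hj))]

/-- The infinite products in front are nonzero, so summability passes to the series without them. -/
theorem summable_PTerm {q a b : ℂ} {m : ℕ} (hq : ‖q‖ < 1) (ha : ∀ n : ℕ, a * q ^ n ≠ 1)
    (hb : ∀ n : ℕ, b * q ^ n ≠ 1) (hab : ∀ n : ℕ, a * b / q ^ m * q ^ n ≠ 1) :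
    Summable (PTerm q m a b) := by
  have h0 : qPochInf q q * qPochInf a q * qPochInf b q ≠ 0 :=
    mul_ne_zero (mul_ne_zero (qPochInf_ne_zero hq (mul_pow_self_ne_one hq))
      (qPochInf_ne_zero hq ha)) (qPochInf_ne_zero hq hb)
  exact (summable_mul_left_iff h0).1 (hasSum_mul_PTerm hq ha hb hab).summable

theorem hasSum_P {q a b y : ℂ} {m : ℕ} (hq : ‖q‖ < 1) (ha : ∀ n : ℕ, a * q ^ n ≠ 1)
    (hb : ∀ n : ℕ, b * q ^ n ≠ 1) (hab : ∀ n : ℕ, a * b / q ^ m * q ^ n ≠ 1)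
    (hy : a * b / q ^ m * q ^ 2 = a * b * y) :
    HasSum (fun R => thetaTerm q a R * pairingValue q y b R) (P q m a b) := by
  rw [P, ← tsum_mul_left, (hasSum_mul_PTerm hq ha hb hab).tsum_eq]
  exact hasSum_thetaTerm_mul_pairingValue hq hy

/-! ### Eliminating R and conclusion. -/

/-- Both sides are values of the pairing on the same polynomial (yX; q)_M, once expanded after the
cancellation and once directly. -/
theorem sum_qBinom_mul_pairingValue {q y : ℂ} (hq : ‖q‖ < 1) {M : ℕ} (hy : y * q ^ M = 1)
    (b : ℂ) (R : ℕ) :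
    ∑ k ∈ range (M + 2), qBinom q (M + 1) k * thetaTerm q (y * q ^ R) k *
        (thetaTerm q b k * pairingValue q y (b * q ^ k) R) =
      ∑ T ∈ range (M + 1), qBinom q M T * thetaTerm q y T * thetaTerm q b T := by
  have h := HasPairing.pochSeries_mul hq (y := y * q ^ R) (N := M + 1)
    fun k _ => hasPairing_pairingValue hq y (b * q ^ k) R
  rw [pochSeries_mul_invPochSeries hq hy] at h
  exact HasSum.unique h (hasPairing_pochSeries hq b y M)

end PartialTheta

theorem mainTheorem1 (m : ℕ) (hm : 2 ≤ m) (q : ℂ) (hq0 : q ≠ 0) (hq1 : ‖q‖ < 1) (a b : ℂ)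
    (ha : ∀ n : ℕ, a * q ^ n ≠ 1)
    (hb : ∀ n : ℕ, b * q ^ n ≠ q ^ (m - 1))
    (hab : ∀ n : ℕ, a * b * q ^ n ≠ q ^ m)
    (hQ : PartialTheta.Q q m (b * q ^ (1 - (m : ℤ))) ≠ 0) :
    Summable (PartialTheta.thetaTerm q a) ∧
    (∀ k ∈ Finset.range m, Summable (PartialTheta.PTerm q m (a * q ^ k) (b * q ^ k))) ∧
    PartialTheta.theta q a =
      ∑ k ∈ Finset.range m,
        PartialTheta.lam q m k b * PartialTheta.P q m (a * q ^ k) (b * q ^ k) := by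
  open PartialTheta Finset in
  obtain ⟨M, rfl⟩ := Nat.exists_eq_add_of_le' hm
  have hak : ∀ k n : ℕ, a * q ^ k * q ^ n ≠ 1 := fun k n => by
    rw [mul_assoc, ← pow_add]; exact ha _
  have hbk : ∀ k n : ℕ, b * q ^ k * q ^ n ≠ 1 := fun k n h => by
    refine hb (k + n + (M + 1)) ?_
    rw [pow_add, pow_add, ← mul_assoc, ← mul_assoc, h, one_mul]
    rfl
  have habk : ∀ k n : ℕ, a * q ^ k * (b * q ^ k) / q ^ (M + 2) * q ^ n ≠ 1 := fun k n h => by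
    refine hab (k + k + n) ?_
    have hM : q ^ (M + 2) ≠ 0 := pow_ne_zero _ hq0
    field_simp at h
    rw [← h]
    ring
  have hθ := (summable_norm_thetaTerm hq1 a).of_norm
  refine ⟨hθ, fun k _ => summable_PTerm hq1 (hak k) (hbk k) (habk k), ?_⟩
  have hy : (q ^ M)⁻¹ * q ^ M = 1 := inv_mul_cancel₀ (pow_ne_zero _ hq0)
  have hP : ∀ k ∈ range (M + 2), HasSum (fun R => lam q (M + 2) k b *
      (thetaTerm q (a * q ^ k) R * pairingValue q (q ^ M)⁻¹ (b * q ^ k) R))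
      (lam q (M + 2) k b * P q (M + 2) (a * q ^ k) (b * q ^ k)) := fun k _ =>
    (hasSum_P hq1 (hak k) (hbk k) (habk k) (by rw [pow_add]; field_simp)).mul_left _
  refine HasSum.unique hθ.hasSum ((hasSum_sum hP).congr_fun fun R => ?_)
  have hlam : ∀ k ∈ range (M + 2), lam q (M + 2) k b *
      (thetaTerm q (a * q ^ k) R * pairingValue q (q ^ M)⁻¹ (b * q ^ k) R) =
      thetaTerm q a R / Q q (M + 2) (b * q ^ (1 - ((M + 2 : ℕ) : ℤ))) *
      (qBinom q (M + 1) k * thetaTerm q ((q ^ M)⁻¹ * q ^ R) k *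
        (thetaTerm q b k * pairingValue q (q ^ M)⁻¹ (b * q ^ k) R)) := by
    intro k hk
    have hk' : k ≤ M + 1 := Nat.lt_succ_iff.1 (mem_range.1 hk)
    have h1 : qPoch (q ^ (((M + 2 : ℕ) : ℤ) - (k : ℤ))) q k / qPoch q q k =
        qBinom q (M + 1) k := by
      have e : q ^ (((M + 2 : ℕ) : ℤ) - (k : ℤ)) = q * q ^ (M + 1 - k) := by
        rw [← pow_succ', ← zpow_natCast]
        congr 1
        push_cast [Nat.cast_sub hk']
        ring
      have h := qPoch_add q q (M + 1 - k) k
      rw [Nat.sub_add_cancel hk'] at h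
      have h3 := qPoch_self_ne_zero hq1 (M + 1 - k)
      rw [e, qBinom, if_pos hk', h]
      field_simp
    -- The factor (q^k)^R comes from replacing a by a q^k; it is what shifts y to y q^R in the
    -- q-binomial weight.
    have h2 : (b * q ^ ((k : ℤ) - ((M + 2 : ℕ) : ℤ) + 1)) ^ k * (q ^ k) ^ R =
        thetaTerm q ((q ^ M)⁻¹ * q ^ R) k * thetaTerm q b k := by
      have e : q ^ ((k : ℤ) - ((M + 2 : ℕ) : ℤ) + 1) * q = q ^ k * (q ^ M)⁻¹ := by
        rw [← zpow_natCast, ← zpow_natCast, ← zpow_neg, ← zpow_add₀ hq0, ← zpow_add_one₀ hq0]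
        congr 1
        push_cast
        ring
      have h3 : ((-1 : ℂ) ^ k) * (-1) ^ k = 1 := by rw [← mul_pow]; simp
      -- The extra q^k completes 2 C(k, 2) to k².
      refine mul_right_cancel₀ (pow_ne_zero k hq0) ?_
      calc _ = b ^ k * (q ^ ((k : ℤ) - ((M + 2 : ℕ) : ℤ) + 1) * q) ^ k * (q ^ k) ^ R := by ring
        _ = ((-1 : ℂ) ^ k) * (-1) ^ k * b ^ k * (q ^ (k ^ 2) * ((q ^ M)⁻¹) ^ k) * (q ^ k) ^ R := by
          rw [e, h3]; ring
        _ = _ := by rw [sq_eq_choose_two]; simp only [thetaTerm]; ring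
    rw [lam, thetaTerm_mul, ← h1]
    calc _ = thetaTerm q a R / Q q (M + 2) (b * q ^ (1 - ((M + 2 : ℕ) : ℤ))) *
          (qPoch (q ^ (((M + 2 : ℕ) : ℤ) - (k : ℤ))) q k / qPoch q q k) *
          ((b * q ^ ((k : ℤ) - ((M + 2 : ℕ) : ℤ) + 1)) ^ k * (q ^ k) ^ R) *
          pairingValue q (q ^ M)⁻¹ (b * q ^ k) R := by
          rw [mul_comm (qPoch q q k)]; ring
      _ = _ := by rw [h2]; ring
  rw [sum_congr rfl hlam, ← mul_sum, sum_qBinom_mul_pairingValue hq1 hy,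
    ← Q_mul_zpow hq0 hq1 M hb, div_mul_cancel₀ _ hQ]
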